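/- Let $\omega>0$, $T_\omega:=2\pi/\omega$, and let $f:\mathbb R\to\mathbb R$ be a real trigonometric polynomial $f(t)=\sum_{n\in\mathbb Z}F_n e^{in\omega t}$ (only finitely many $F_n\in\mathbb C$ are non-zero) with $F_0=0$. For $h:\mathbb R\to\mathbb C$ let $M(h):=\lim_{T\to\infty}\frac1{2T}\int_{-T}^{T}h(t)\,dt$ denote the mean value, and put $$q(t):=\exp\Big(i\int_0^t f(\tau)\,d\tau\Big),\qquad \mathcal Q_1(t):=q(t)^2\int_0^t q(\tau)^{-2}\,d\tau .$$ For $\epsilon\in\mathbb R$ let $U(t)=U(t,0)\in\mathrm{Mat}(2,\mathbb C)$ be the propagator of the Schrödinger equation $$ i\Phi'(t)=\big(\epsilon\sigma_1+f(t)\sigma_3\big)\Phi(t),\qquad \sigma_1=\begin{pmatrix}0&1\\1&0\end{pmatrix},\quad \sigma_3=\begin{pmatrix}1&0\\0&-1\end{pmatrix},$$ for $\Phi:\mathbb R\to\mathbb C^2$; that is, the solutions are exactly the functions $\Phi(t)=U(t)\Phi(0)$ with $\Phi(0)\in\mathbb C^2$ arbitrary. Assume that one of the following two conditions holds: (I)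 $M(q^2)\neq 0$; (II) $M(q^2)=0$ but $M(\mathcal Q_1)\neq 0$. Then there is a constant $K>0$, depending only on $\omega$ and the Fourier coefficients $F_n$, such that for every real $\epsilon$ with $|\epsilon|<K$ there exist $\Omega=\Omega(\epsilon)\in\mathbb R$ and $T_\omega$-periodic functions $u_{11}^\pm,u_{12}^\pm:\mathbb R\to\mathbb C$ (depending on $\epsilon$) such that for all $t\in\mathbb R$ $$U(t)=\begin{pmatrix}U_{11}(t)&U_{12}(t)\\-\overline{U_{12}(t)}&\overline{U_{11}(t)}\end{pmatrix},$$ $$U_{11}(t)=e^{-i\Omega t}u_{11}^-(t)+e^{i\Omega t}u_{11}^+(t),\qquad U_{12}(t)=e^{-i\Omega t}u_{12}^-(t)+e^{i\Omega t}u_{12}^+(t).$$ The functions $u_{11}^\pm$ and $u_{12}^\pm$ have Fourier expansions $$u_{11}^\pm(t)=\sum_{n\in\mathbb Z}\mathcal U_{11}^\pm(n)e^{in\omega t},\qquad u_{12}^\pm(t)=\sum_{n\in\mathbb Z}\mathcal U_{12}^\pm(n)e^{in\omega t}$$ that converge absolutely, and uniformly in $t\in\mathbb R$. Moreover, these objects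 can be chosen such that $\Omega$ and, for each $n\in\mathbb Z$, the Fourier coefficients $\mathcal U_{11}^\pm(n)$ and $\mathcal U_{12}^\pm(n)$, as functions of $\epsilon$, are given for all real $\epsilon$ with $|\epsilon|<K$ by power series in $\epsilon$ (with coefficients independent of $\epsilon$) that converge absolutely. -/

import Mathlib

open Filter Topology
open scoped Matrix

noncomputable section

namespace TwoLevel

/-- The Pauli matrix `σ₁`. -/
def pauli1 : Matrix (Fin 2) (Fin 2) ℂ := !![0, 1; 1, 0]

/-- The Pauli matrix `σ₃`. -/
def pauli3 : Matrix (Fin 2) (Fin 2) ℂ := !![1, 0; 0, -1]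

/-- The Hamiltonian `H₂(t) = ε σ₁ + f(t) σ₃`. -/
def hamiltonian (ε : ℝ) (f : ℝ → ℝ) (t : ℝ) : Matrix (Fin 2) (Fin 2) ℂ :=
  (ε : ℂ) • pauli1 + (f t : ℂ) • pauli3

/-- `Φ : ℝ → ℂ²` solves the Schrödinger equation `i Φ'(t) = H₂(t) Φ(t)` on all of `ℝ`,
written as `Φ'(t) = -i H₂(t) Φ(t)`. -/
def IsSolution (ε : ℝ) (f : ℝ → ℝ) (Φ : ℝ → Fin 2 → ℂ) : Prop :=
  ∀ t : ℝ, HasDerivAt Φ (-Complex.I • (hamiltonian ε f t *ᵥ Φ t)) t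

/-- `U(t) = U(t, 0)` is the propagator of the Schrödinger equation: for every initial value `v`
the function `t ↦ U(t) v` is a solution that starts at `v`, and every solution is of the form
`Φ(t) = U(t) Φ(0)`. These properties determine `U`. -/
structure IsPropagator (ε : ℝ) (f : ℝ → ℝ) (U : ℝ → Matrix (Fin 2) (Fin 2) ℂ) : Prop where
  at_zero : U 0 = 1
  solution : ∀ v : Fin 2 → ℂ, IsSolution ε f (fun t => U t *ᵥ v)
  eq_mulVec : ∀ Φ : ℝ → Fin 2 → ℂ, IsSolution ε f Φ → ∀ t : ℝ, Φ t = U t *ᵥ Φ 0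

/-- `q(t) = exp (i ∫₀ᵗ f(τ) dτ)`. -/
def q (f : ℝ → ℝ) (t : ℝ) : ℂ :=
  Complex.exp (Complex.I * ((∫ τ in (0 : ℝ)..t, f τ : ℝ) : ℂ))

/-- `𝒬₁(t) = q(t)² ∫₀ᵗ q(τ)⁻² dτ`. -/
def Q1 (f : ℝ → ℝ) (t : ℝ) : ℂ :=
  q f t ^ 2 * ∫ τ in (0 : ℝ)..t, (q f τ ^ 2)⁻¹

/-- The mean value `M(h) = lim_{T → ∞} (1 / 2T) ∫_{-T}^{T} h(t) dt` exists and equals `m`. -/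
def HasMean (h : ℝ → ℂ) (m : ℂ) : Prop :=
  Tendsto (fun T : ℝ => ((1 / (2 * T) : ℝ) : ℂ) * ∫ t in (-T)..T, h t) atTop (𝓝 m)

/-- Condition I: `M(q²) ≠ 0`. -/
def ConditionI (f : ℝ → ℝ) : Prop :=
  ∃ m : ℂ, m ≠ 0 ∧ HasMean (fun t => q f t ^ 2) m

/-- Condition II: `M(q²) = 0` but `M(𝒬₁) ≠ 0`. -/
def ConditionII (f : ℝ → ℝ) : Prop :=
  HasMean (fun t => q f t ^ 2) 0 ∧ ∃ m : ℂ, m ≠ 0 ∧ HasMean (Q1 f) m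

/-- `u` is `2π/ω`-periodic and `u(t) = ∑_{n ∈ ℤ} c(n) e^{i n ω t}`, where the series converges
absolutely, and uniformly in `t ∈ ℝ`. -/
structure HasFourierExpansion (ω : ℝ) (u : ℝ → ℂ) (c : ℤ → ℂ) : Prop where
  periodic : Function.Periodic u (2 * Real.pi / ω)
  absolutely : Summable fun n : ℤ => ‖c n‖
  uniformly : TendstoUniformly
    (fun (s : Finset ℤ) (t : ℝ) =>
      ∑ n ∈ s, c n * Complex.exp (Complex.I * (n : ℂ) * (ω : ℂ) * (t : ℂ))) u atTop

/-- On `(-K, K)` the function `φ` is the sum of a power series `∑ₖ εᵏ aₖ`, with coefficients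
independent of `ε`, that converges absolutely for every `ε` with `|ε| < K`. -/
def HasAbsPowerSeries {E : Type*} [NormedAddCommGroup E] [NormedSpace ℝ E]
    (K : ℝ) (φ : ℝ → E) : Prop :=
  ∃ a : ℕ → E, ∀ ε : ℝ, |ε| < K →
    (Summable fun k : ℕ => ‖ε ^ k • a k‖) ∧ HasSum (fun k : ℕ => ε ^ k • a k) (φ ε)

end TwoLevel

end

/-! Floquet theory reduces everything to the monodromy `M(ε) = U(T)`, with `T = 2π/ω`: `U(t+T) =
U(t) M(ε)`, and if `M Q = e^{iμT} Q` then `e^{-iμt} U(t) Q` is periodic. It remains to choose the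
phase and the spectral projection of `M(ε)` analytically in `ε`.

The interaction picture gives `U` a Dyson series, so `U(t)` is entire in the coupling. For real `ε`
it lies in SU(2) (`det_propagator`, `propagator_conj`), and `M(0) = 1` because `f` has mean zero
(`propagator_zero_period`).

The eigenvalues collide at `ε = 0`, yet do not branch there (`exists_analytic_spectral_data`). Write
`M = m + ε^k N` with `m` half the trace and `N` traceless, analytic and nonzero at `0`. For real
`ε`, `N` is anti-Hermitian, so `det N > 0` near `0`, and `s = √(det N)` is analytic. The eigenvalues
are `m ± i ε^k s`, and the projection onto the upper one is `(1 - iN/s)/2`.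

Splitting `U = U P + U (1 - P)` gives the two Floquet terms. They are C² in `t`, so their Fourier
series converge absolutely; each coefficient is an integral over one period, hence holomorphic in
the coupling. -/

namespace TwoLevel

/-! ### Dyson series of a linear equation with complex coupling -/

section Dyson

variable {E : Type*} [NormedAddCommGroup E] [NormedSpace ℂ E]

/-- The `k`-th coefficient of the Dyson series of `x' = z A(t) x`, `x(0) = v`. -/
noncomputable def dyson (A : ℝ → E →L[ℂ] E) (v : E) : ℕ → ℝ → E
  | 0 => fun _ => v
  | k + 1 => fun t => ∫ s in (0 : ℝ)..t, A s (dyson A v k s)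

/-- The Dyson series, the solution of `x' = z A(t) x`, `x(0) = v`. -/
noncomputable def dysonSum (A : ℝ → E →L[ℂ] E) (v : E) (z : ℂ) (t : ℝ) : E :=
  ∑' k : ℕ, z ^ k • dyson A v k t

variable {A : ℝ → E →L[ℂ] E} (hA : Continuous A) {C : ℝ} (hC : ∀ t, ‖A t‖ ≤ C) (v : E)

include hA in
lemma continuous_dyson (k : ℕ) : Continuous (dyson A v k) := by
  induction k with
  | zero => exact continuous_const
  | succ k ih =>
    exact intervalIntegral.continuous_primitive
      (fun a b => (hA.clm_apply ih).intervalIntegrable a b) 0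

include hA in
lemma hasDerivAt_dyson_succ [CompleteSpace E] (k : ℕ) (t : ℝ) :
    HasDerivAt (dyson A v (k + 1)) (A t (dyson A v k t)) t :=
  intervalIntegral.integral_hasDerivAt_right
    ((hA.clm_apply (continuous_dyson hA v k)).intervalIntegrable 0 t)
    ((hA.clm_apply (continuous_dyson hA v k)).stronglyMeasurableAtFilter _ _)
    (hA.clm_apply (continuous_dyson hA v k)).continuousAt

include hC in
lemma norm_dyson_le (k : ℕ) (t : ℝ) :
    ‖dyson A v k t‖ ≤ (C * |t|) ^ k / k.factorial * ‖v‖ := by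
  have hC0 : 0 ≤ C := (norm_nonneg _).trans (hC 0)
  induction k generalizing t with
  | zero => simp [dyson]
  | succ k ih =>
    have hb : ∀ s, ‖A s (dyson A v k s)‖ ≤
        C ^ (k + 1) / k.factorial * ‖v‖ * |s - 0| ^ k := fun s => by
      calc ‖A s (dyson A v k s)‖ ≤ C * ((C * |s|) ^ k / k.factorial * ‖v‖) :=
            (A s).le_of_opNorm_le_of_le (hC s) (ih s)
        _ = _ := by rw [sub_zero, mul_pow]; ring
    calc ‖dyson A v (k + 1) t‖
        ≤ ∫ s in Set.uIoc 0 t, C ^ (k + 1) / k.factorial * ‖v‖ * |s - 0| ^ k := by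
          rw [dyson, intervalIntegral.norm_intervalIntegral_eq]
          refine MeasureTheory.norm_integral_le_of_norm_le ?_ (Eventually.of_forall hb)
          exact (intervalIntegrable_iff.mp
            (Continuous.intervalIntegrable (by fun_prop) 0 t))
      _ = _ := by
          rw [MeasureTheory.integral_const_mul, integral_pow_abs_sub_uIoc, sub_zero, mul_pow,
            Nat.factorial_succ]
          push_cast
          field_simp

-- One `R` bounds both coupling and time, so a single Weierstrass majorant serves for holomorphy in
-- `z`, joint continuity and differentiation in `t`.
include hC in
lemma norm_pow_smul_dyson_le {R : ℝ} {z : ℂ} (hz : ‖z‖ ≤ R) {t : ℝ} (ht : |t| ≤ R) (k : ℕ) :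
    ‖z ^ k • dyson A v k t‖ ≤ (R * (C * R)) ^ k / k.factorial * ‖v‖ := by
  have hC0 : 0 ≤ C := (norm_nonneg _).trans (hC 0)
  rw [norm_smul, norm_pow]
  calc ‖z‖ ^ k * ‖dyson A v k t‖ ≤ R ^ k * ((C * R) ^ k / k.factorial * ‖v‖) := by
        have hR : 0 ≤ R := (norm_nonneg z).trans hz
        gcongr
        exact (norm_dyson_le hC v k t).trans (by gcongr)
    _ = _ := by rw [mul_pow]; ring

lemma dysonSum_apply_zero (z : ℂ) : dysonSum A v z 0 = v := by
  rw [dysonSum, tsum_eq_single 0]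
  · simp [dyson]
  · rintro (_ | k) hk
    · exact absurd rfl hk
    · simp [dyson]

variable [CompleteSpace E]

include hC in
lemma summable_dyson (z : ℂ) (t : ℝ) :
    Summable fun k : ℕ => z ^ k • dyson A v k t :=
  .of_norm_bounded ((Real.summable_pow_div_factorial _).mul_right ‖v‖)
    (norm_pow_smul_dyson_le hC v (le_max_left ‖z‖ |t|) (le_max_right ‖z‖ |t|))

include hC in
lemma differentiable_dysonSum (t : ℝ) : Differentiable ℂ fun z => dysonSum A v z t := by
  intro z
  have := Complex.differentiableOn_tsum_of_summable_norm
    (F := fun (k : ℕ) (z : ℂ) => z ^ k • dyson A v k t) (U := Metric.ball 0 (max (‖z‖ + 1) |t|))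
    ((Real.summable_pow_div_factorial _).mul_right ‖v‖) (fun k => by fun_prop) Metric.isOpen_ball
    (fun k w hw => norm_pow_smul_dyson_le hC v (mem_ball_zero_iff.mp hw).le (le_max_right _ _) k)
  refine (this z ?_).differentiableAt (Metric.isOpen_ball.mem_nhds ?_) <;>
  · rw [mem_ball_zero_iff]
    exact (lt_add_one _).trans_le (le_max_left _ _)

include hA hC in
lemma continuous_dysonSum : Continuous fun p : ℂ × ℝ => dysonSum A v p.1 p.2 := by
  rw [continuous_iff_continuousAt]
  intro p
  have := continuousOn_tsum
    (f := fun (k : ℕ) (p : ℂ × ℝ) => p.1 ^ k • dyson A v k p.2) (s := Metric.ball 0 (‖p‖ + 1))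
    (fun k => ((continuous_fst.pow k).smul
      ((continuous_dyson hA v k).comp continuous_snd)).continuousOn)
    ((Real.summable_pow_div_factorial _).mul_right ‖v‖)
    (fun k w hw => norm_pow_smul_dyson_le hC v
      ((norm_fst_le w).trans (mem_ball_zero_iff.mp hw).le)
      ((norm_snd_le w).trans (mem_ball_zero_iff.mp hw).le) k)
  exact this.continuousAt (Metric.isOpen_ball.mem_nhds (by simp))

include hA hC in
lemma hasDerivAt_dysonSum (z : ℂ) (t : ℝ) :
    HasDerivAt (dysonSum A v z) (z • A t (dysonSum A v z t)) t := by
  have hC0 : 0 ≤ C := (norm_nonneg _).trans (hC 0)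
  set R := max ‖z‖ (|t| + 1) with hR
  have hR0 : 0 ≤ R := (norm_nonneg z).trans (le_max_left _ _)
  have ht : t ∈ Metric.ball (0 : ℝ) R := by
    rw [mem_ball_zero_iff, Real.norm_eq_abs]
    exact (lt_add_one _).trans_le (le_max_right _ _)
  -- The constant term of index `0` is split off, so that differentiating the term of index `k + 1`
  -- returns `A` applied to the term of index `k`.
  have key : HasDerivAt (fun s => ∑' k : ℕ, z ^ (k + 1) • dyson A v (k + 1) s)
      (∑' k : ℕ, z ^ (k + 1) • A t (dyson A v k t)) t := by
    refine hasDerivAt_tsum_of_isPreconnected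
      (u := fun k : ℕ => R * C * ((R * (C * R)) ^ k / k.factorial * ‖v‖))
      (((Real.summable_pow_div_factorial _).mul_right ‖v‖).mul_left _) Metric.isOpen_ball
      (convex_ball (0 : ℝ) R).isPreconnected
      (fun k s _ => (hasDerivAt_dyson_succ hA v k s).const_smul (z ^ (k + 1))) ?_ ht
      ((summable_nat_add_iff 1).mpr (summable_dyson hC v z t)) ht
    intro k s hs
    calc ‖z ^ (k + 1) • A s (dyson A v k s)‖ = ‖z‖ * ‖A s (z ^ k • dyson A v k s)‖ := by
          rw [map_smul, norm_smul, norm_smul, norm_pow, norm_pow, pow_succ]; ring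
      _ ≤ R * (C * ((R * (C * R)) ^ k / k.factorial * ‖v‖)) := by
          gcongr
          · exact le_max_left _ _
          · exact (A s).le_of_opNorm_le_of_le (hC s) (norm_pow_smul_dyson_le hC v
              (le_max_left _ _) (mem_ball_zero_iff.mp hs).le k)
      _ = _ := by ring
  have hfun : dysonSum A v z = fun s => v + ∑' k : ℕ, z ^ (k + 1) • dyson A v (k + 1) s := by
    ext s
    rw [dysonSum, (summable_dyson hC v z s).tsum_eq_zero_add]
    simp [dyson]
  have hval : z • A t (dysonSum A v z t) = ∑' k : ℕ, z ^ (k + 1) • A t (dyson A v k t) := by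
    rw [dysonSum, (A t).map_tsum (summable_dyson hC v z t), ← tsum_const_smul'']
    exact tsum_congr fun k => by rw [map_smul, smul_smul, pow_succ']
  rw [hval, hfun]
  exact key.const_add v

end Dyson

/-! ### Interaction picture -/

section InteractionPicture

variable {f : ℝ → ℝ}

lemma norm_q (f : ℝ → ℝ) (t : ℝ) : ‖q f t‖ = 1 := by
  rw [q, mul_comm, Complex.norm_exp_ofReal_mul_I]

lemma q_ne_zero (f : ℝ → ℝ) (t : ℝ) : q f t ≠ 0 := Complex.exp_ne_zero _

lemma hasDerivAt_q (hf : Continuous f) (t : ℝ) :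
    HasDerivAt (q f) (Complex.I * f t * q f t) t := by
  have h := (intervalIntegral.integral_hasDerivAt_right (hf.intervalIntegrable 0 t)
    (hf.stronglyMeasurableAtFilter _ _) hf.continuousAt).ofReal_comp
  have := (h.const_mul Complex.I).cexp
  rwa [mul_comm] at this

lemma continuous_q (hf : Continuous f) : Continuous (q f) :=
  continuous_iff_continuousAt.mpr fun t => (hasDerivAt_q hf t).continuousAt

/-- The elementary operator `v ↦ v_j e_i` on `ℂ²`. -/
noncomputable def elemOp (i j : Fin 2) : (Fin 2 → ℂ) →L[ℂ] (Fin 2 → ℂ) :=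
  (ContinuousLinearMap.single ℂ (fun _ : Fin 2 => ℂ) i).comp (ContinuousLinearMap.proj j)

/-- `-i σ₁` in the interaction picture. -/
noncomputable def interaction (f : ℝ → ℝ) (t : ℝ) : (Fin 2 → ℂ) →L[ℂ] (Fin 2 → ℂ) :=
  (-Complex.I * q f t ^ 2) • elemOp 0 1 + (-Complex.I * (q f t ^ 2)⁻¹) • elemOp 1 0

lemma interaction_apply_zero (t : ℝ) (v : Fin 2 → ℂ) :
    interaction f t v 0 = -Complex.I * q f t ^ 2 * v 1 := by
  simp [interaction, elemOp]

lemma interaction_apply_one (t : ℝ) (v : Fin 2 → ℂ) :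
    interaction f t v 1 = -Complex.I * (q f t ^ 2)⁻¹ * v 0 := by
  simp [interaction, elemOp]

lemma continuous_interaction (hf : Continuous f) : Continuous (interaction f) := by
  have h := (continuous_q hf).pow 2
  exact ((continuous_const.mul h).smul continuous_const).add
    ((continuous_const.mul (h.inv₀ fun t => pow_ne_zero 2 (q_ne_zero f t))).smul continuous_const)

lemma norm_interaction_le (f : ℝ → ℝ) (t : ℝ) :
    ‖interaction f t‖ ≤ ‖elemOp 0 1‖ + ‖elemOp 1 0‖ := by
  refine (norm_add_le _ _).trans (add_le_add ?_ ?_) <;>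
  · rw [norm_smul]
    simp [norm_q]

/-- The solution of the Schrödinger equation with complex coupling `z` and initial value `v`. -/
noncomputable def schrodingerSol (f : ℝ → ℝ) (v : Fin 2 → ℂ) (z : ℂ) (t : ℝ) : Fin 2 → ℂ :=
  ![(q f t)⁻¹ * dysonSum (interaction f) v z t 0, q f t * dysonSum (interaction f) v z t 1]

lemma schrodingerSol_apply_zero (v : Fin 2 → ℂ) (z : ℂ) : schrodingerSol f v z 0 = v := by
  ext i
  fin_cases i <;> simp [schrodingerSol, dysonSum_apply_zero, q]

lemma schrodingerSol_zero (v : Fin 2 → ℂ) (t : ℝ) :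
    schrodingerSol f v 0 t = ![(q f t)⁻¹ * v 0, q f t * v 1] := by
  have : dysonSum (interaction f) v 0 t = v := by
    rw [dysonSum, tsum_eq_single 0 fun k hk => by simp [hk]]
    simp [dyson]
  rw [schrodingerSol, this]

lemma differentiable_schrodingerSol (v : Fin 2 → ℂ) (t : ℝ) (i : Fin 2) :
    Differentiable ℂ fun z => schrodingerSol f v z t i := by
  have h := differentiable_pi.mp (differentiable_dysonSum (norm_interaction_le f) v t)
  fin_cases i
  · exact (h 0).const_mul _
  · exact (h 1).const_mul _

lemma continuous_schrodingerSol (hf : Continuous f) (v : Fin 2 → ℂ) (i : Fin 2) :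
    Continuous fun p : ℂ × ℝ => schrodingerSol f v p.1 p.2 i := by
  have h := continuous_pi_iff.mp
    (continuous_dysonSum (continuous_interaction hf) (norm_interaction_le f) v)
  have hq := (continuous_q hf).comp (continuous_snd (X := ℂ))
  fin_cases i
  · exact (hq.inv₀ fun p => q_ne_zero f p.2).mul (h 0)
  · exact hq.mul (h 1)

/-- Since `q' = i f q`, the factor `diag(q⁻¹, q)` produces the `f σ₃` term, and it turns the entries
`q^{±2}` of `interaction` back into `σ₁`. -/
lemma hasDerivAt_schrodingerSol (hf : Continuous f) (v : Fin 2 → ℂ) (z : ℂ) (t : ℝ) :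
    HasDerivAt (fun t => schrodingerSol f v z t 0)
        (-Complex.I * (f t * schrodingerSol f v z t 0 + z * schrodingerSol f v z t 1)) t ∧
      HasDerivAt (fun t => schrodingerSol f v z t 1)
        (-Complex.I * (z * schrodingerSol f v z t 0 - f t * schrodingerSol f v z t 1)) t := by
  have h := hasDerivAt_pi.mp
    (hasDerivAt_dysonSum (continuous_interaction hf) (norm_interaction_le f) v z t)
  have hq := hasDerivAt_q hf t
  have hq0 := q_ne_zero f t
  constructor
  · convert! (hq.inv hq0).mul (h 0) using 1
    simp only [schrodingerSol, Pi.smul_apply, interaction_apply_zero, Matrix.cons_val_zero,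
      Matrix.cons_val_one, smul_eq_mul, Pi.inv_apply]
    field_simp
    ring
  · convert! hq.mul (h 1) using 1
    simp only [schrodingerSol, Pi.smul_apply, interaction_apply_one, Matrix.cons_val_zero,
      Matrix.cons_val_one, smul_eq_mul]
    field_simp
    ring

end InteractionPicture

/-! ### The equation in components and uniqueness of solutions -/

lemma isSolution_iff {ε : ℝ} {f : ℝ → ℝ} {Φ : ℝ → Fin 2 → ℂ} :
    IsSolution ε f Φ ↔ ∀ t,
      HasDerivAt (fun t => Φ t 0) (-Complex.I * (f t * Φ t 0 + ε * Φ t 1)) t ∧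
      HasDerivAt (fun t => Φ t 1) (-Complex.I * (ε * Φ t 0 - f t * Φ t 1)) t := by
  refine forall_congr' fun t => ?_
  rw [hasDerivAt_pi, Fin.forall_fin_two]
  have e0 : (-Complex.I • (hamiltonian ε f t *ᵥ Φ t)) 0 =
      -Complex.I * (f t * Φ t 0 + ε * Φ t 1) := by
    simp [hamiltonian, pauli1, pauli3, dotProduct, Fin.sum_univ_two]
  have e1 : (-Complex.I • (hamiltonian ε f t *ᵥ Φ t)) 1 =
      -Complex.I * (ε * Φ t 0 - f t * Φ t 1) := by
    simp [hamiltonian, pauli1, pauli3, dotProduct, Fin.sum_univ_two]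
    ring
  rw [e0, e1]

lemma IsSolution.unique {ε : ℝ} {f : ℝ → ℝ} {B : ℝ} (hB : ∀ t, |f t| ≤ B)
    {Φ Ψ : ℝ → Fin 2 → ℂ} (hΦ : IsSolution ε f Φ) (hΨ : IsSolution ε f Ψ) (h0 : Φ 0 = Ψ 0) :
    Φ = Ψ := by
  refine ODE_solution_unique_univ (v := fun t x => -Complex.I • (hamiltonian ε f t *ᵥ x))
    (K := (B + |ε|).toNNReal) (s := fun _ => Set.univ) (t₀ := 0)
    (fun t => LipschitzWith.lipschitzOnWith (LipschitzWith.of_dist_le_mul fun x y => ?_))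
    (fun t => ⟨hΦ t, trivial⟩) (fun t => ⟨hΨ t, trivial⟩) h0
  have hB0 : 0 ≤ B := (abs_nonneg _).trans (hB 0)
  rw [Real.coe_toNNReal _ (by positivity), dist_eq_norm, dist_eq_norm, ← smul_sub,
    ← Matrix.mulVec_sub, norm_smul, norm_neg, Complex.norm_I, one_mul]
  generalize x - y = v
  have key : ∀ i j : Fin 2, |f t| * ‖v i‖ + |ε| * ‖v j‖ ≤ (B + |ε|) * ‖v‖ := fun i j => by
    rw [add_mul]
    gcongr
    · exact hB t
    · exact norm_le_pi_norm v i
    · exact norm_le_pi_norm v j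
  refine (pi_norm_le_iff_of_nonneg (by positivity)).mpr fun i => ?_
  fin_cases i
  · refine le_trans ?_ (key 0 1)
    simp only [hamiltonian, pauli1, pauli3, Matrix.mulVec, dotProduct, Fin.sum_univ_two]
    refine (norm_add_le _ _).trans ?_
    simp
  · refine le_trans ?_ (key 1 0)
    simp only [hamiltonian, pauli1, pauli3, Matrix.mulVec, dotProduct, Fin.sum_univ_two]
    refine (norm_add_le _ _).trans ?_
    simp [add_comm]

/-! ### The propagator: determinant, symmetry, smoothness, Floquet relation -/

section Propagator

/-- The propagator of the Schrödinger equation with complex coupling `z`. -/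
noncomputable def propagator (f : ℝ → ℝ) (z : ℂ) (t : ℝ) : Matrix (Fin 2) (Fin 2) ℂ :=
  Matrix.of fun i j => schrodingerSol f (Pi.single j 1) z t i

variable {f : ℝ → ℝ}

lemma propagator_apply_zero (z : ℂ) : propagator f z 0 = 1 := by
  ext i j
  simp [propagator, schrodingerSol_apply_zero, Matrix.one_apply, Pi.single_apply]

lemma differentiable_propagator (t : ℝ) (i j : Fin 2) :
    Differentiable ℂ fun z => propagator f z t i j :=
  differentiable_schrodingerSol _ t i

lemma continuous_propagator (hf : Continuous f) (i j : Fin 2) :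
    Continuous fun p : ℂ × ℝ => propagator f p.1 p.2 i j :=
  continuous_schrodingerSol hf _ i

lemma hasDerivAt_propagator (hf : Continuous f) (z : ℂ) (t : ℝ) (j : Fin 2) :
    HasDerivAt (fun t => propagator f z t 0 j)
        (-Complex.I * (f t * propagator f z t 0 j + z * propagator f z t 1 j)) t ∧
      HasDerivAt (fun t => propagator f z t 1 j)
        (-Complex.I * (z * propagator f z t 0 j - f t * propagator f z t 1 j)) t :=
  hasDerivAt_schrodingerSol hf _ z t

/-- Liouville's formula: the Hamiltonian is traceless. -/
lemma det_propagator (hf : Continuous f) (z : ℂ) (t : ℝ) :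
    propagator f z t 0 0 * propagator f z t 1 1 -
      propagator f z t 0 1 * propagator f z t 1 0 = 1 := by
  have hd : ∀ s, HasDerivAt (fun s => propagator f z s 0 0 * propagator f z s 1 1 -
      propagator f z s 0 1 * propagator f z s 1 0) 0 s := fun s => by
    have h0 := hasDerivAt_propagator hf z s 0
    have h1 := hasDerivAt_propagator hf z s 1
    convert! (h0.1.mul h1.2).sub (h1.1.mul h0.2) using 1
    ring
  have := is_const_of_deriv_eq_zero (fun s => (hd s).differentiableAt) (fun s => (hd s).deriv) t 0
  simpa [propagator_apply_zero] using this

/-- Bootstrapping through the equation; both rows must be carried along because they are coupled.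
Order two is what makes the Fourier coefficients decay like `n⁻²`. -/
lemma contDiff_propagator {f : ℝ → ℝ} (hf : ContDiff ℝ 1 f) (z : ℂ) (j : Fin 2) :
    ContDiff ℝ 2 (fun t => propagator f z t 0 j) := by
  have hd := fun t => hasDerivAt_propagator hf.continuous z t j
  have hfc : ContDiff ℝ 1 fun t => (f t : ℂ) := Complex.ofRealCLM.contDiff.comp hf
  have step : ∀ n : ℕ, n ≤ 1 → ContDiff ℝ n (fun t => propagator f z t 0 j) →
      ContDiff ℝ n (fun t => propagator f z t 1 j) →
      ContDiff ℝ (n + 1) (fun t => propagator f z t 0 j) ∧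
        ContDiff ℝ (n + 1) (fun t => propagator f z t 1 j) := by
    intro n hn h0 h1
    have hfn : ContDiff ℝ n fun t => (f t : ℂ) := hfc.of_le (by exact_mod_cast hn)
    refine ⟨contDiff_succ_iff_deriv.mpr ⟨fun t => (hd t).1.differentiableAt, by simp, ?_⟩,
      contDiff_succ_iff_deriv.mpr ⟨fun t => (hd t).2.differentiableAt, by simp, ?_⟩⟩
    · rw [funext fun t => (hd t).1.deriv]
      exact contDiff_const.mul ((hfn.mul h0).add (contDiff_const.mul h1))
    · rw [funext fun t => (hd t).2.deriv]
      exact contDiff_const.mul ((contDiff_const.mul h0).sub (hfn.mul h1))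
  have h1 := step 0 zero_le_one
    (contDiff_zero.mpr (continuous_iff_continuousAt.mpr fun t => (hd t).1.continuousAt))
    (contDiff_zero.mpr (continuous_iff_continuousAt.mpr fun t => (hd t).2.continuousAt))
  have h2 := step 1 le_rfl (by simpa using h1.1) (by simpa using h1.2)
  convert! h2.1 using 1

variable {B : ℝ}

lemma isSolution_propagator_mulVec (hf : Continuous f) (ε : ℝ) (v : Fin 2 → ℂ) :
    IsSolution ε f fun t => propagator f ε t *ᵥ v := by
  refine isSolution_iff.mpr fun t => ?_
  have h0 := hasDerivAt_propagator hf ε t 0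
  have h1 := hasDerivAt_propagator hf ε t 1
  simp only [Matrix.mulVec, dotProduct, Fin.sum_univ_two]
  constructor
  · convert! (h0.1.mul_const (v 0)).add (h1.1.mul_const (v 1)) using 1
    ring
  · convert! (h0.2.mul_const (v 0)).add (h1.2.mul_const (v 1)) using 1
    ring

lemma isPropagator_propagator (hf : Continuous f) (hB : ∀ t, |f t| ≤ B) (ε : ℝ) :
    IsPropagator ε f fun t => propagator f ε t where
  at_zero := propagator_apply_zero _
  solution := isSolution_propagator_mulVec hf ε
  eq_mulVec Φ hΦ t := congrFun (hΦ.unique hB (isSolution_propagator_mulVec hf ε (Φ 0))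
    (by simp [propagator_apply_zero])) t

/-- For real `ε`, the map `(x, y) ↦ (-ȳ, x̄)` preserves solutions. It sends the first column of the
propagator to a solution starting at `(0, 1)`, which must be the second column. -/
lemma propagator_conj (hf : Continuous f) (hB : ∀ t, |f t| ≤ B) (ε t : ℝ) :
    propagator f ε t 1 0 = -(starRingEnd ℂ) (propagator f ε t 0 1) ∧
      propagator f ε t 1 1 = (starRingEnd ℂ) (propagator f ε t 0 0) := by
  have hsol : IsSolution ε f fun t =>
      ![-(starRingEnd ℂ) (propagator f ε t 1 0), (starRingEnd ℂ) (propagator f ε t 0 0)] := by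
    refine isSolution_iff.mpr fun t => ?_
    have h0 := hasDerivAt_propagator hf ε t 0
    constructor
    · convert! h0.2.star.neg using 1
      simp
      ring_nf
    · convert! h0.1.star using 1
      simp
      ring
  have h := (isPropagator_propagator hf hB ε).eq_mulVec _ hsol t
  have e0 := congrFun h 0
  have e1 := congrFun h 1
  simp [propagator_apply_zero, Matrix.mulVec, dotProduct, Fin.sum_univ_two] at e0 e1
  refine ⟨?_, e1.symm⟩
  rw [← e0]
  simp

lemma propagator_add_period (hf : Continuous f) (hB : ∀ t, |f t| ≤ B) {T : ℝ}
    (hper : Function.Periodic f T) (ε t : ℝ) :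
    propagator f ε (t + T) = propagator f ε t * propagator f ε T := by
  ext i j
  have hsol : IsSolution ε f fun t => propagator f ε (t + T) *ᵥ Pi.single j 1 := fun t => by
    have := (isSolution_propagator_mulVec hf ε (Pi.single j 1) (t + T)).comp_add_const t T
    simpa only [hamiltonian, hper t] using this
  have h := congrFun ((isPropagator_propagator hf hB ε).eq_mulVec _ hsol t) i
  rw [zero_add, Matrix.mulVec_mulVec] at h
  simpa using h

end Propagator

/-! ### Trigonometric polynomials and the monodromy at zero coupling -/

lemma exp_two_pi_div {ω : ℝ} (hω : ω ≠ 0) (n : ℤ) :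
    Complex.exp (Complex.I * n * ω * (2 * Real.pi / ω : ℝ)) = 1 := by
  rw [Complex.exp_eq_one_iff]
  refine ⟨n, ?_⟩
  have : (ω : ℂ) ≠ 0 := Complex.ofReal_ne_zero.mpr hω
  push_cast
  field_simp

section TrigonometricPolynomial

variable {ω : ℝ} {f : ℝ → ℝ} {F : ℤ →₀ ℂ}
  (hf : ∀ t : ℝ, (f t : ℂ) =
    F.sum fun n c => c * Complex.exp (Complex.I * (n : ℂ) * (ω : ℂ) * (t : ℂ)))

include hf

lemma contDiff_of_trigPoly : ContDiff ℝ 1 f := by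
  have : f = fun t : ℝ => (∑ n ∈ F.support,
      F n * Complex.exp (Complex.I * (n : ℂ) * (ω : ℂ) * (t : ℂ))).re := by
    ext t
    have := congrArg Complex.re (hf t)
    rwa [Complex.ofReal_re] at this
  rw [this]
  refine Complex.reCLM.contDiff.comp (ContDiff.sum fun n _ => ?_)
  exact contDiff_const.mul (contDiff_const.mul Complex.ofRealCLM.contDiff).cexp

lemma abs_le_of_trigPoly (t : ℝ) : |f t| ≤ ∑ n ∈ F.support, ‖F n‖ := by
  rw [← Real.norm_eq_abs, ← Complex.norm_real, hf, Finsupp.sum]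
  refine (norm_sum_le _ _).trans (Finset.sum_le_sum fun n _ => ?_)
  have : Complex.I * n * ω * t = ((n * ω * t : ℝ) : ℂ) * Complex.I := by push_cast; ring
  rw [norm_mul, this, Complex.norm_exp_ofReal_mul_I, mul_one]

lemma periodic_of_trigPoly (hω : ω ≠ 0) : Function.Periodic f (2 * Real.pi / ω) := fun t => by
  have : ((f (t + 2 * Real.pi / ω) : ℝ) : ℂ) = f t := by
    rw [hf, hf]
    refine Finsupp.sum_congr fun n _ => ?_
    rw [Complex.ofReal_add, mul_add, Complex.exp_add, exp_two_pi_div hω, mul_one]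
  exact_mod_cast this

lemma integral_period_of_trigPoly (hω : ω ≠ 0) (hF0 : F 0 = 0) :
    ∫ t in (0 : ℝ)..(2 * Real.pi / ω), f t = 0 := by
  have : ((∫ t in (0 : ℝ)..(2 * Real.pi / ω), f t : ℝ) : ℂ) = 0 := by
    rw [← intervalIntegral.integral_ofReal]
    simp_rw [hf, Finsupp.sum]
    rw [intervalIntegral.integral_finsetSum fun n _ =>
      Continuous.intervalIntegrable (by fun_prop) _ _]
    refine Finset.sum_eq_zero fun n hn => ?_
    have hn0 : n ≠ 0 := by
      rintro rfl
      exact (Finsupp.mem_support_iff.mp hn) hF0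
    have hc : Complex.I * n * ω ≠ 0 := mul_ne_zero (mul_ne_zero Complex.I_ne_zero
      (Int.cast_ne_zero.mpr hn0)) (Complex.ofReal_ne_zero.mpr hω)
    rw [intervalIntegral.integral_const_mul, integral_exp_mul_complex hc, exp_two_pi_div hω]
    simp
  exact_mod_cast this

/-- Without coupling the propagator is `diag(q⁻¹, q)`, and mean zero of `f` gives `q = 1` after one
period. -/
lemma propagator_zero_period (hω : ω ≠ 0) (hF0 : F 0 = 0) :
    propagator f 0 (2 * Real.pi / ω) = 1 := by
  have : q f (2 * Real.pi / ω) = 1 := by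
    rw [q, integral_period_of_trigPoly hf hω hF0]
    simp
  ext i j
  fin_cases i <;> fin_cases j <;> simp [propagator, schrodingerSol_zero, this]

end TrigonometricPolynomial

/-! ### Analytic spectral data of the monodromy -/

lemma eventually_eq_of_punctured {φ ψ : ℂ → ℂ} (hφ : ContinuousAt φ 0) (hψ : ContinuousAt ψ 0)
    {k : ℕ} (h : ∀ᶠ ε : ℝ in 𝓝 0, (ε : ℂ) ^ k * φ ε = (ε : ℂ) ^ k * (starRingEnd ℂ) (ψ ε)) :
    ∀ᶠ ε : ℝ in 𝓝 0, φ ε = (starRingEnd ℂ) (ψ ε) := by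
  have hof : ContinuousAt (fun ε : ℝ => (ε : ℂ)) 0 := Complex.continuous_ofReal.continuousAt
  have h1 : ContinuousAt (fun ε : ℝ => φ ε) 0 :=
    ContinuousAt.comp (f := fun ε : ℝ => (ε : ℂ)) (by simpa using hφ) hof
  have h2 : ContinuousAt (fun ε : ℝ => (starRingEnd ℂ) (ψ ε)) 0 :=
    Complex.continuous_conj.continuousAt.comp
      (ContinuousAt.comp (f := fun ε : ℝ => (ε : ℂ)) (by simpa using hψ) hof)
  refine (h1.eventuallyEq_nhds_iff_eventuallyEq_nhdsNE h2).mp ?_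
  filter_upwards [eventually_nhdsWithin_of_eventually_nhds h, self_mem_nhdsWithin] with ε hε hne
  exact mul_left_cancel₀ (pow_ne_zero k (Complex.ofReal_ne_zero.mpr hne)) hε

/-- An analytic family of matrices that starts at the identity and lies in `SU(2)` for real
parameters has, near `0`, an analytic eigenvalue phase `θ`, real for real parameters, and an
analytic spectral projection. -/
lemma exists_analytic_spectral_data {a b c d : ℂ → ℂ} (ha : AnalyticAt ℂ a 0)
    (hb : AnalyticAt ℂ b 0) (hc : AnalyticAt ℂ c 0) (hd : AnalyticAt ℂ d 0)
    (ha0 : a 0 = 1) (hb0 : b 0 = 0) (hc0 : c 0 = 0) (hd0 : d 0 = 1)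
    (had : ∀ ε : ℝ, d ε = (starRingEnd ℂ) (a ε)) (hbc : ∀ ε : ℝ, b ε = -(starRingEnd ℂ) (c ε))
    (hdet : ∀ ε : ℝ, a ε * d ε - b ε * c ε = 1) :
    ∃ (θ : ℂ → ℂ) (P : ℂ → Matrix (Fin 2) (Fin 2) ℂ), AnalyticAt ℂ θ 0 ∧
      (∀ i j, AnalyticAt ℂ (fun z => P z i j) 0) ∧
      ∀ᶠ ε : ℝ in 𝓝 0, (θ ε).im = 0 ∧
        !![a ε, b ε; c ε, d ε] * P ε = Complex.exp (Complex.I * θ ε) • P ε ∧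
        !![a ε, b ε; c ε, d ε] * (1 - P ε) =
          Complex.exp (-Complex.I * θ ε) • (1 - P ε) := by
  have hreal : Tendsto (fun ε : ℝ => (ε : ℂ)) (𝓝 0) (𝓝 0) := by
    simpa using Complex.continuous_ofReal.tendsto 0
  have hw : AnalyticAt ℂ (fun z => ((a z - d z) / 2, b z, c z)) 0 :=
    ((ha.sub hd).div_const).prod (hb.prod hc)
  -- If the traceless part vanishes identically, the matrix is a scalar of square `1` near `1`,
  -- hence the identity.
  by_cases htriv : ∀ᶠ z in 𝓝 (0 : ℂ), ((a z - d z) / 2, b z, c z) = 0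
  · refine ⟨fun _ => 0, fun _ => 1, analyticAt_const, fun _ _ => analyticAt_const, ?_⟩
    have hne : ∀ᶠ z in 𝓝 (0 : ℂ), a z ≠ -1 :=
      ha.continuousAt.eventually_ne (by rw [ha0]; norm_num)
    filter_upwards [hreal.eventually htriv, hreal.eventually hne] with ε h1 h2
    simp only [Prod.mk_eq_zero] at h1
    obtain ⟨h11, h12, h13⟩ := h1
    have h3 := hdet ε
    have h4 : d ε = a ε := by linear_combination (-2) * h11
    rw [h12, h4] at h3
    have h5 : a ε = 1 := by
      have : (a ε - 1) * (a ε + 1) = 0 := by linear_combination h3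
      rcases mul_eq_zero.mp this with h | h
      · linear_combination h
      · exact absurd (by linear_combination h) h2
    rw [h4, h5, h12, h13, ← Matrix.one_fin_two]
    simp
  -- The three entries are treated as one vector, so `k` is their common order of vanishing and the
  -- quotient is nonzero at `0`.
  obtain ⟨k, g, hg, hg0, hgk⟩ :=
    (hw.exists_eventuallyEq_pow_smul_nonzero_iff).mpr htriv
  simp only [sub_zero] at hgk
  obtain ⟨y, hy⟩ : ∃ y : ℂ → ℂ, y = fun z => (g z).1 := ⟨_, rfl⟩
  obtain ⟨β, hβ⟩ : ∃ β : ℂ → ℂ, β = fun z => (g z).2.1 := ⟨_, rfl⟩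
  obtain ⟨γ, hγ⟩ : ∃ γ : ℂ → ℂ, γ = fun z => (g z).2.2 := ⟨_, rfl⟩
  have hya : AnalyticAt ℂ y 0 := hy ▸ analyticAt_fst.comp hg
  have hβa : AnalyticAt ℂ β 0 :=
    hβ ▸ analyticAt_fst.comp (analyticAt_snd.comp hg)
  have hγa : AnalyticAt ℂ γ 0 :=
    hγ ▸ analyticAt_snd.comp (analyticAt_snd.comp hg)
  have hgk' : ∀ᶠ z in 𝓝 (0 : ℂ),
      (a z - d z) / 2 = z ^ k * y z ∧ b z = z ^ k * β z ∧ c z = z ^ k * γ z := by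
    filter_upwards [hgk] with z hz
    rw [Prod.ext_iff, Prod.ext_iff] at hz
    simpa [hy, hβ, hγ] using hz
  have hk : k ≠ 0 := by
    rintro rfl
    have := hgk.self_of_nhds
    rw [ha0, hb0, hc0, hd0] at this
    simp only [pow_zero, one_smul] at this
    exact hg0 (this ▸ by simp)
  -- Anti-Hermitian symmetry survives division by `ε^k`, which is real.
  have hyr : ∀ᶠ ε : ℝ in 𝓝 0, y ε = (starRingEnd ℂ) (-y ε) := by
    refine eventually_eq_of_punctured (k := k) (ψ := fun z => -y z) hya.continuousAt
      hya.continuousAt.neg ?_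
    filter_upwards [hreal.eventually hgk'] with ε hε
    have := congrArg (starRingEnd ℂ) hε.1
    simp only [had, map_div₀, map_sub, Complex.conj_conj, map_mul, map_pow, Complex.conj_ofReal,
      map_ofNat] at this
    rw [map_neg, mul_neg, ← this, ← hε.1, had]
    ring
  have hβr : ∀ᶠ ε : ℝ in 𝓝 0, β ε = (starRingEnd ℂ) (-γ ε) := by
    refine eventually_eq_of_punctured (k := k) (ψ := fun z => -γ z) hβa.continuousAt
      hγa.continuousAt.neg ?_
    filter_upwards [hreal.eventually hgk'] with ε hε
    have := congrArg (starRingEnd ℂ) hε.2.2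
    simp only [map_mul, map_pow, Complex.conj_ofReal] at this
    rw [map_neg, mul_neg, ← this, ← hε.2.1, hbc]
  -- The determinant of the reduced matrix. On the real axis it is a sum of squared moduli, so it is
  -- positive at `0` and has an analytic square root.
  obtain ⟨D, hD⟩ : ∃ D : ℂ → ℂ, D = fun z => -(y z) ^ 2 - β z * γ z := ⟨_, rfl⟩
  have hDa : AnalyticAt ℂ D 0 := hD ▸ ((hya.pow 2).neg.sub (hβa.mul hγa))
  have hDr : ∀ᶠ ε : ℝ in 𝓝 0, D ε = ((Complex.normSq (y ε) + Complex.normSq (γ ε) : ℝ) : ℂ) := by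
    filter_upwards [hyr, hβr] with ε h1 h2
    simp only [hD]
    rw [Complex.ofReal_add, Complex.normSq_eq_conj_mul_self, Complex.normSq_eq_conj_mul_self, h2]
    rw [map_neg] at h1 ⊢
    linear_combination (-y ε) * h1
  have hpos0 : 0 < Complex.normSq (y 0) + Complex.normSq (γ 0) := by
    have hβ0 := hβr.self_of_nhds
    rw [Complex.ofReal_zero] at hβ0
    by_contra hcon
    have h1 := Complex.normSq_nonneg (y 0)
    have h2 := Complex.normSq_nonneg (γ 0)
    have hy0 : y 0 = 0 := Complex.normSq_eq_zero.mp (by linarith)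
    have hγ0 : γ 0 = 0 := Complex.normSq_eq_zero.mp (by linarith)
    rw [hγ0, neg_zero, map_zero] at hβ0
    subst hy hβ hγ
    exact hg0 (Prod.ext hy0 (Prod.ext hβ0 hγ0))
  have hD0 : D 0 ∈ Complex.slitPlane := by
    have := hDr.self_of_nhds
    rw [Complex.ofReal_zero] at this
    rw [this]
    exact Complex.ofReal_mem_slitPlane.mpr hpos0
  obtain ⟨s, hs⟩ : ∃ s : ℂ → ℂ, s = fun z => Complex.exp (Complex.log (D z) / 2) := ⟨_, rfl⟩
  have hsa : AnalyticAt ℂ s 0 := hs ▸ (hDa.clog hD0).div_const.cexp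
  have hs_ne : ∀ z, s z ≠ 0 := fun z => hs ▸ Complex.exp_ne_zero _
  have hDne : ∀ᶠ z in 𝓝 (0 : ℂ), D z ≠ 0 :=
    hDa.continuousAt.eventually_ne (Complex.slitPlane_ne_zero hD0)
  have hs2 : ∀ z, D z ≠ 0 → s z ^ 2 = D z := fun z hz => by
    rw [hs, ← Complex.exp_nat_mul]
    push_cast
    rw [mul_div_cancel₀ _ two_ne_zero, Complex.exp_log hz]
  obtain ⟨lam, hlam⟩ : ∃ lam : ℂ → ℂ,
      lam = fun z => (a z + d z) / 2 + Complex.I * z ^ k * s z := ⟨_, rfl⟩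
  have hlama : AnalyticAt ℂ lam 0 := hlam ▸
    (((ha.add hd).div_const).add ((analyticAt_const.mul (analyticAt_id.pow k)).mul hsa))
  have hlam0 : lam 0 = 1 := by
    simp [hlam, ha0, hd0, hk]
  -- With `N = !![y, β; γ, -y]` one has `N² = -s²`, so `(1 - iN/s)/2` projects onto the eigenvalue
  -- `is` of `N`. The principal logarithm is analytic because `lam 0 = 1`, which uses `k ≠ 0`.
  refine ⟨fun z => -Complex.I * Complex.log (lam z),
    fun z => !![(1 - Complex.I * y z / s z) / 2, -Complex.I * β z / s z / 2;
      -Complex.I * γ z / s z / 2, (1 + Complex.I * y z / s z) / 2],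
    analyticAt_const.mul (hlama.clog (by rw [hlam0]; exact Complex.one_mem_slitPlane)), ?_, ?_⟩
  · intro i j
    have h1 := ((analyticAt_const (v := Complex.I)).mul hya).div hsa (hs_ne 0)
    fin_cases i <;> fin_cases j
    · exact (analyticAt_const.sub h1).div_const
    · exact ((analyticAt_const.mul hβa).div hsa (hs_ne 0)).div_const
    · exact ((analyticAt_const.mul hγa).div hsa (hs_ne 0)).div_const
    · exact (analyticAt_const.add h1).div_const
  filter_upwards [hDr, hreal.eventually hDne, hreal.eventually hgk'] with ε h1 h2 ⟨h3, h4, h5⟩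
  have hss := hs2 _ h2
  have hsr : (starRingEnd ℂ) (s ε) = s ε := by
    simp only [hs, h1]
    rw [← Complex.ofReal_log (add_nonneg (Complex.normSq_nonneg _) (Complex.normSq_nonneg _)),
      ← Complex.exp_conj, map_div₀, Complex.conj_ofReal, map_ofNat]
  have hD' : D ε = -(y ε) ^ 2 - β ε * γ ε := by rw [hD]
  have hprod : lam ε * ((a ε + d ε) / 2 - Complex.I * (ε : ℂ) ^ k * s ε) = 1 := by
    rw [← hdet ε, hlam]
    linear_combination (-(ε : ℂ) ^ (2 * k) * s ε ^ 2) * Complex.I_sq + (ε : ℂ) ^ (2 * k) * hss +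
      (ε : ℂ) ^ (2 * k) * hD' + ((a ε - d ε) / 2 + (ε : ℂ) ^ k * y ε) * h3 +
      c ε * h4 + (ε : ℂ) ^ k * β ε * h5
  have hconj : (starRingEnd ℂ) (lam ε) = (a ε + d ε) / 2 - Complex.I * (ε : ℂ) ^ k * s ε := by
    simp only [hlam, had, map_add, map_mul, map_pow, map_div₀, map_ofNat, Complex.conj_conj,
      Complex.conj_I, Complex.conj_ofReal, hsr]
    ring
  have hlam_ne : lam ε ≠ 0 := left_ne_zero_of_mul_eq_one hprod
  -- The conjugate of `lam ε` is the other eigenvalue, and their product is the determinant `1`.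
  have hnorm : ‖lam ε‖ = 1 := by
    rw [← hconj, Complex.mul_conj, Complex.normSq_eq_norm_sq] at hprod
    have : ‖lam ε‖ ^ 2 = 1 := by exact_mod_cast hprod
    exact (pow_eq_one_iff_of_nonneg (norm_nonneg _) two_ne_zero).mp this
  have hexp1 : Complex.exp (Complex.I * (-Complex.I * Complex.log (lam ε))) =
      (a ε + d ε) / 2 + Complex.I * (ε : ℂ) ^ k * s ε := by
    rw [← mul_assoc, mul_neg, Complex.I_mul_I, neg_neg, one_mul, Complex.exp_log hlam_ne, hlam]
  have hexp2 : Complex.exp (-Complex.I * (-Complex.I * Complex.log (lam ε))) =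
      (a ε + d ε) / 2 - Complex.I * (ε : ℂ) ^ k * s ε := by
    rw [← mul_assoc, neg_mul_neg, Complex.I_mul_I, neg_one_mul, Complex.exp_neg,
      Complex.exp_log hlam_ne]
    exact (eq_inv_of_mul_eq_one_right hprod).symm
  have hsne := hs_ne ε
  have ea : a ε = (a ε + d ε) / 2 + (ε : ℂ) ^ k * y ε := by linear_combination h3
  have ed : d ε = (a ε + d ε) / 2 - (ε : ℂ) ^ k * y ε := by linear_combination -h3
  refine ⟨?_, ?_, ?_⟩
  · simp [Complex.log_re, hnorm]
  · rw [hexp1]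
    generalize (a ε + d ε) / 2 = m at *
    rw [ea, ed, h4, h5]
    rw [hD'] at hss
    ext i j
    fin_cases i <;> fin_cases j <;> simp [Matrix.mul_apply, Fin.sum_univ_two] <;> field_simp
    · linear_combination -(ε : ℂ) ^ k * Complex.I * hss + (ε : ℂ) ^ k * y ε * s ε * Complex.I_sq
    · linear_combination β ε * (ε : ℂ) ^ k * s ε * Complex.I_sq
    · linear_combination γ ε * (ε : ℂ) ^ k * s ε * Complex.I_sq
    · linear_combination -(ε : ℂ) ^ k * Complex.I * hss - (ε : ℂ) ^ k * y ε * s ε * Complex.I_sq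
  · rw [hexp2]
    generalize (a ε + d ε) / 2 = m at *
    rw [ea, ed, h4, h5]
    rw [hD'] at hss
    ext i j
    fin_cases i <;> fin_cases j <;> simp [Matrix.mul_apply, Fin.sum_univ_two] <;> field_simp
    · linear_combination (ε : ℂ) ^ k * Complex.I * hss + (ε : ℂ) ^ k * y ε * s ε * Complex.I_sq
    · linear_combination β ε * (ε : ℂ) ^ k * s ε * Complex.I_sq
    · linear_combination γ ε * (ε : ℂ) ^ k * s ε * Complex.I_sq
    · linear_combination (ε : ℂ) ^ k * Complex.I * hss - (ε : ℂ) ^ k * y ε * s ε * Complex.I_sq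

/-! ### Fourier series of C² periodic functions -/

/-- The `n`-th Fourier coefficient of a `2π/ω`-periodic function. -/
noncomputable def fourierC (ω : ℝ) (u : ℝ → ℂ) (n : ℤ) : ℂ :=
  (1 / (2 * Real.pi / ω) : ℝ) • ∫ t in (0 : ℝ)..(2 * Real.pi / ω),
    Complex.exp (-(Complex.I * n * ω * t)) * u t

lemma fourier_two_pi_div {ω : ℝ} (hω : ω ≠ 0) (n : ℤ) (t : ℝ) :
    fourier (T := 2 * Real.pi / ω) n (t : AddCircle (2 * Real.pi / ω)) =
      Complex.exp (Complex.I * n * ω * t) := by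
  rw [fourier_coe_apply]
  congr 1
  have : (ω : ℂ) ≠ 0 := by exact_mod_cast hω
  have : (Real.pi : ℂ) ≠ 0 := by exact_mod_cast Real.pi_ne_zero
  push_cast
  field_simp

/-- A twice continuously differentiable periodic function is the sum of its absolutely convergent
Fourier series. -/
lemma hasFourierExpansion_of_contDiff {ω : ℝ} (hω : 0 < ω) {u : ℝ → ℂ}
    (hper : Function.Periodic u (2 * Real.pi / ω)) (hc : ContDiff ℝ 2 u) :
    HasFourierExpansion ω u (fourierC ω u) := by
  obtain ⟨u', u'', hu, hu', hu''⟩ : ∃ u' u'' : ℝ → ℂ, (∀ t, HasDerivAt u (u' t) t) ∧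
      (∀ t, HasDerivAt u' (u'' t) t) ∧ Continuous u'' := by
    have h1 : ContDiff ℝ 1 (deriv u) := (contDiff_succ_iff_deriv (n := 1).mp hc).2.2
    exact ⟨deriv u, deriv (deriv u),
      fun t => (hc.differentiable two_ne_zero t).hasDerivAt,
      fun t => (h1.differentiable one_ne_zero t).hasDerivAt, h1.continuous_deriv le_rfl⟩
  have hT : 0 < 2 * Real.pi / ω := by positivity
  have hper' : Function.Periodic u' (2 * Real.pi / ω) := fun t => by
    have h1 : HasDerivAt (fun s => u (s + 2 * Real.pi / ω)) (u' (t + 2 * Real.pi / ω)) t :=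
      (hu _).comp_add_const t _
    rw [funext hper] at h1
    exact h1.unique (hu t)
  set T := 2 * Real.pi / ω with hTdef
  have : Fact (0 < T) := ⟨hT⟩
  have hlift : ∀ n, fourierC ω u n = fourierCoeffOn hT u n := fun n => by
    rw [fourierCoeffOn_eq_integral, fourierC, ← hTdef, sub_zero]
    congr 1
    refine intervalIntegral.integral_congr fun t _ => ?_
    simp only [smul_eq_mul]
    rw [hTdef, fourier_two_pi_div hω.ne']
    push_cast
    congr 2
    ring
  have hcont : Continuous u := continuous_iff_continuousAt.mpr fun t => (hu t).continuousAt
  have hcont' : Continuous u' := continuous_iff_continuousAt.mpr fun t => (hu' t).continuousAt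
  obtain ⟨B, hB⟩ : ∃ B, ∀ n, ‖fourierCoeffOn hT u'' n‖ ≤ B := by
    obtain ⟨B, hB⟩ := (isCompact_Icc (a := (0:ℝ)) (b := T)).exists_bound_of_continuousOn
      hu''.continuousOn
    refine ⟨‖(1 / (T - 0))‖ * (B * |T - 0|), fun n => ?_⟩
    rw [fourierCoeffOn_eq_integral, norm_smul]
    gcongr
    refine intervalIntegral.norm_integral_le_of_norm_le_const fun t ht => ?_
    rw [norm_smul]
    simp only [fourier_apply, Circle.norm_coe, one_mul]
    rw [Set.uIoc_of_le hT.le] at ht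
    exact hB t ⟨ht.1.le, ht.2⟩
  -- Two integrations by parts; periodicity kills the boundary terms.
  have hcoef : ∀ n : ℤ, n ≠ 0 → fourierCoeffOn hT u n =
      (T / (2 * Real.pi * Complex.I * n)) ^ 2 * fourierCoeffOn hT u'' n := by
    intro n hn
    rw [fourierCoeffOn_of_hasDerivAt hT hn (fun t _ => hu t) (hcont'.intervalIntegrable _ _),
      fourierCoeffOn_of_hasDerivAt hT hn (fun t _ => hu' t) (hu''.intervalIntegrable _ _)]
    have h0 : u T - u 0 = 0 := by simpa [sub_eq_zero] using hper 0
    have h0' : u' T - u' 0 = 0 := by simpa [sub_eq_zero] using hper' 0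
    rw [h0, h0']
    push_cast
    ring
  have hsum : Summable (fourierC ω u) := by
    have hs : Summable fun n : ℤ => (T / (2 * Real.pi)) ^ 2 * B * (1 / (n : ℝ) ^ 2) :=
      (Real.summable_one_div_int_pow.mpr one_lt_two).mul_left _
    refine Summable.of_norm_bounded_eventually hs ?_
    have : ∀ᶠ n : ℤ in cofinite, n ≠ 0 := (Set.finite_singleton (0 : ℤ)).eventually_cofinite_notMem
    filter_upwards [this] with n hn
    rw [hlift, hcoef n hn, norm_mul, norm_pow, norm_div]
    have e : ‖(T : ℂ)‖ / ‖2 * (Real.pi : ℂ) * Complex.I * n‖ = T / (2 * Real.pi) / |(n : ℝ)| := by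
      simp only [norm_mul, Complex.norm_I, Complex.norm_real, Complex.norm_ofNat,
        Complex.norm_intCast, Real.norm_eq_abs, abs_of_pos hT, abs_of_pos Real.pi_pos, mul_one]
      exact (div_div _ _ _).symm
    rw [e, div_pow, sq_abs]
    calc _ ≤ (T / (2 * Real.pi)) ^ 2 / (n : ℝ) ^ 2 * B := by gcongr; exact hB n
      _ = _ := by ring
  let g : C(AddCircle T, ℂ) :=
    ⟨hper.lift, continuous_coinduced_dom.mpr hcont⟩
  have hg : fourierCoeff g = fourierC ω u := by
    ext n
    rw [fourierCoeff_eq_intervalIntegral _ n 0, fourierC, ← hTdef, zero_add]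
    congr 1
    refine intervalIntegral.integral_congr fun t _ => ?_
    simp only [smul_eq_mul]
    refine congrArg₂ (· * ·) ((fourier_two_pi_div hω.ne' (-n) t).trans ?_) rfl
    push_cast
    congr 1
    ring
  refine ⟨hper, hsum.norm, ?_⟩
  have hpt : ∀ t : ℝ, ∑' n : ℤ, fourierC ω u n * Complex.exp (Complex.I * n * ω * t) = u t := by
    intro t
    have := has_pointwise_sum_fourier_series_of_summable (f := g) (hg ▸ hsum) (t : AddCircle T)
    rw [hg] at this
    refine Eq.trans (tsum_congr fun n => ?_) this.tsum_eq
    rw [hTdef, fourier_two_pi_div hω.ne', smul_eq_mul]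
  refine Eq.subst (motive := fun v => TendstoUniformly _ v atTop) (funext hpt)
    (tendstoUniformly_tsum hsum.norm fun n t => ?_)
  rw [norm_mul]
  refine (mul_le_of_le_one_right (norm_nonneg _) ?_)
  have : Complex.I * n * ω * t = ((n * ω * t : ℝ) : ℂ) * Complex.I := by push_cast; ring
  rw [this, Complex.norm_exp_ofReal_mul_I]

/-! ### Holomorphic dependence on the coupling -/

/-- A function that is holomorphic on a disc has an absolutely convergent power series there. -/
lemma hasAbsPowerSeries_of_differentiableOn {K : ℝ} {φ : ℂ → ℂ}
    (hφ : DifferentiableOn ℂ φ (Metric.ball 0 K)) : HasAbsPowerSeries K fun ε : ℝ => φ ε := by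
  refine ⟨fun k => (k.factorial : ℂ)⁻¹ * iteratedDeriv k φ 0, fun ε hε => ?_⟩
  have h : HasSum (fun k : ℕ => ε ^ k • ((k.factorial : ℂ)⁻¹ * iteratedDeriv k φ 0)) (φ ε) := by
    convert! Complex.hasSum_taylorSeries_on_ball hφ (z := (ε : ℂ)) (by simpa using hε) using 2 with k
    rw [sub_zero, Complex.real_smul, smul_eq_mul, smul_eq_mul, Complex.ofReal_pow]
    ring
  exact ⟨h.summable.norm, h⟩

lemma HasAbsPowerSeries.re {K : ℝ} {φ : ℝ → ℂ} (h : HasAbsPowerSeries K φ) :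
    HasAbsPowerSeries K fun ε => (φ ε).re := by
  obtain ⟨a, ha⟩ := h
  refine ⟨fun k => (a k).re, fun ε hε => ?_⟩
  have h : HasSum (fun k : ℕ => ε ^ k • (a k).re) (φ ε).re := by
    simpa only [Complex.smul_re] using Complex.hasSum_re (ha ε hε).2
  exact ⟨h.summable.norm, h⟩

/-- An interval integral of a continuous function depending holomorphically on a parameter is
holomorphic in that parameter. -/
lemma differentiableOn_intervalIntegral {U : Set ℂ} (hU : IsOpen U) {G : ℂ → ℝ → ℂ} {a b : ℝ}
    (hG : ContinuousOn (fun p : ℂ × ℝ => G p.1 p.2) (U ×ˢ Set.univ))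
    (hd : ∀ t, DifferentiableOn ℂ (fun z => G z t) U) :
    DifferentiableOn ℂ (fun z => ∫ t in a..b, G z t) U := by
  classical
  intro z₀ hz₀
  obtain ⟨r, hr, hrU⟩ := Metric.nhds_basis_closedBall.mem_iff.mp (hU.mem_nhds hz₀)
  have hcont : ∀ z ∈ U, Continuous (G z) := fun z hz =>
    hG.comp_continuous (Continuous.prodMk_right z) fun t => ⟨hz, trivial⟩
  obtain ⟨B, hB⟩ := ((isCompact_closedBall z₀ r).prod
    (isCompact_uIcc (a := a) (b := b))).exists_bound_of_continuousOn
    (hG.mono (Set.prod_mono hrU (Set.subset_univ _)))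
  have hhalf : Metric.ball z₀ (r / 2) ⊆ U :=
    (Metric.ball_subset_closedBall.trans
      (Metric.closedBall_subset_closedBall (by linarith))).trans hrU
  have hdiff : ∀ t, ∀ z ∈ U, HasDerivAt (fun w => G w t) (deriv (fun w => G w t) z) z :=
    fun t z hz => ((hd t z hz).differentiableAt (hU.mem_nhds hz)).hasDerivAt
  -- Cauchy's estimate: a disc of radius `r / 2` about a point of the half-sized ball stays in the
  -- closed ball where `B` bounds `G`.
  have hbound : ∀ t ∈ Set.uIoc a b, ∀ z ∈ Metric.ball z₀ (r / 2),
      ‖deriv (fun w => G w t) z‖ ≤ B / (r / 2) := by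
    intro t ht z hz
    have hsub : Metric.closedBall z (r / 2) ⊆ Metric.closedBall z₀ r := by
      apply Metric.closedBall_subset_closedBall'
      rw [Metric.mem_ball] at hz
      linarith
    refine Complex.norm_deriv_le_of_forall_mem_sphere_norm_le (by positivity) ?_ fun w hw =>
      hB (w, t) ⟨hsub (Metric.sphere_subset_closedBall hw), Set.uIoc_subset_uIcc ht⟩
    refine DifferentiableOn.diffContOnCl ?_
    refine (hd t).mono ?_
    rw [closure_ball _ (by positivity)]
    exact hsub.trans hrU
  refine (intervalIntegral.hasDerivAt_integral_of_dominated_loc_of_deriv_le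
    (F := G) (F' := fun z t => deriv (fun w => G w t) z) (bound := fun _ => B / (r / 2))
    (Metric.ball_mem_nhds z₀ (half_pos hr)) ?_ ((hcont z₀ hz₀).intervalIntegrable a b) ?_
    (Eventually.of_forall hbound) (by simp)
    (Eventually.of_forall fun t _ z hz =>
      hdiff t z (hhalf hz))).2.differentiableAt.differentiableWithinAt
  · filter_upwards [hU.mem_nhds hz₀] with z hz using (hcont z hz).aestronglyMeasurable
  -- The derivative is measurable in `t` as a limit of difference quotients; the value `0` covers
  -- increments leaving `U`, where nothing is known of `G`.
  · refine aestronglyMeasurable_of_tendsto_ae (𝓝[≠] (0 : ℂ))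
      (f := fun h t => if z₀ + h ∈ U then h⁻¹ • (G (z₀ + h) t - G z₀ t) else 0) (fun h => ?_)
      (Eventually.of_forall fun t => ?_)
    · split_ifs with hh
      · have : Continuous fun t => h⁻¹ • (G (z₀ + h) t - G z₀ t) :=
          ((hcont _ hh).sub (hcont _ hz₀)).const_smul h⁻¹
        exact this.aestronglyMeasurable
      · exact MeasureTheory.aestronglyMeasurable_const
    · refine (hasDerivAt_iff_tendsto_slope_zero.mp (hdiff t z₀ hz₀)).congr' ?_
      have : ∀ᶠ h : ℂ in 𝓝[≠] 0, z₀ + h ∈ U := by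
        refine Filter.Tendsto.eventually_mem (Filter.Tendsto.mono_left ?_ nhdsWithin_le_nhds)
          (hU.mem_nhds hz₀)
        simpa using (continuous_const_add z₀).tendsto (0 : ℂ)
      filter_upwards [this] with h hh
      rw [if_pos hh]

/-! ### Floquet factors -/

/-- The `2π/ω`-periodic Floquet factor `e^{-iμt} (U(t) Q)_{1j}` of the first row of `U(t) Q`. -/
noncomputable def floquetPart (f : ℝ → ℝ) (μ : ℂ → ℂ) (Q : ℂ → Matrix (Fin 2) (Fin 2) ℂ)
    (j : Fin 2) (z : ℂ) (t : ℝ) : ℂ :=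
  Complex.exp (-(Complex.I * μ z * t)) * (propagator f z t * Q z) 0 j

lemma floquetPart_periodic {f : ℝ → ℝ} (hf : Continuous f) {B T : ℝ} (hB : ∀ t, |f t| ≤ B)
    (hper : Function.Periodic f T) {μ : ℂ → ℂ} {Q : ℂ → Matrix (Fin 2) (Fin 2) ℂ} {ε : ℝ}
    (hQ : propagator f ε T * Q ε = Complex.exp (Complex.I * μ ε * T) • Q ε) (j : Fin 2) :
    Function.Periodic (floquetPart f μ Q j ε) T := fun t => by
  rw [floquetPart, floquetPart, propagator_add_period hf hB hper, Matrix.mul_assoc, hQ,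
    Matrix.mul_smul, Matrix.smul_apply, smul_eq_mul, ← mul_assoc, ← Complex.exp_add]
  congr 2
  push_cast
  ring

lemma contDiff_floquetPart {f : ℝ → ℝ} (hf : ContDiff ℝ 1 f) (μ : ℂ → ℂ)
    (Q : ℂ → Matrix (Fin 2) (Fin 2) ℂ) (j : Fin 2) (z : ℂ) :
    ContDiff ℝ 2 (floquetPart f μ Q j z) := by
  have h : floquetPart f μ Q j z = fun t : ℝ => Complex.exp (-(Complex.I * μ z * t)) *
      (propagator f z t 0 0 * Q z 0 j + propagator f z t 0 1 * Q z 1 j) := by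
    ext t
    rw [floquetPart, Matrix.mul_apply, Fin.sum_univ_two]
  rw [h]
  exact ((contDiff_const.mul Complex.ofRealCLM.contDiff).neg.cexp).mul
    (((contDiff_propagator hf z 0).mul contDiff_const).add
      ((contDiff_propagator hf z 1).mul contDiff_const))

/-- The coefficient is holomorphic on the whole disc where `μ` and `Q` are, so the radius `K` is the
same for every `n`. -/
lemma hasAbsPowerSeries_fourierC_floquetPart {f : ℝ → ℝ} (hf : Continuous f) {K : ℝ} {μ : ℂ → ℂ}
    {Q : ℂ → Matrix (Fin 2) (Fin 2) ℂ} (hμ : DifferentiableOn ℂ μ (Metric.ball 0 K))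
    (hQ : ∀ i j, DifferentiableOn ℂ (fun z => Q z i j) (Metric.ball 0 K)) (ω : ℝ) (j : Fin 2)
    (n : ℤ) : HasAbsPowerSeries K fun ε : ℝ => fourierC ω (floquetPart f μ Q j ε) n := by
  refine hasAbsPowerSeries_of_differentiableOn
    (φ := fun z => fourierC ω (floquetPart f μ Q j z) n) ?_
  simp only [fourierC, floquetPart, Matrix.mul_apply, Fin.sum_univ_two]
  refine DifferentiableOn.const_smul (R := ℝ) ?_ _
  refine differentiableOn_intervalIntegral Metric.isOpen_ball ?_ ?_
  · have hU := fun i => (continuous_propagator hf 0 i).continuousOn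
      (s := Metric.ball 0 K ×ˢ Set.univ)
    have hfst : Set.MapsTo Prod.fst (Metric.ball (0 : ℂ) K ×ˢ (Set.univ : Set ℝ))
      (Metric.ball 0 K) := fun p hp => hp.1
    have hμ' := hμ.continuousOn.comp continuousOn_fst hfst
    have hQ' := fun i => (hQ i j).continuousOn.comp continuousOn_fst hfst
    have ht : ContinuousOn (fun p : ℂ × ℝ => (p.2 : ℂ)) (Metric.ball 0 K ×ˢ Set.univ) :=
      (Complex.continuous_ofReal.comp continuous_snd).continuousOn
    exact ((continuousOn_const.mul ht).neg.cexp).mul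
      (((continuousOn_const.mul hμ').mul ht).neg.cexp.mul
        (((hU 0).mul (hQ' 0)).add ((hU 1).mul (hQ' 1))))
  · intro t
    have hU := fun i => (differentiable_propagator (f := f) t 0 i).differentiableOn
      (s := Metric.ball 0 K)
    exact (((hμ.const_mul _).mul_const _).fun_neg.cexp.mul
        (((hU 0).mul (hQ 0 j)).add ((hU 1).mul (hQ 1 j)))).const_mul _

end TwoLevel

/-! ### Assembly of the theorem -/

open TwoLevel in
/-- The monodromy matrix is real analytic in `ε` with values in `SU(2)` and equals `1` at `ε = 0`,
so its spectral data are analytic in `ε` to whatever order it is degenerate at `ε = 0`. The two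
mean value conditions correspond to orders one and two; the argument works for every order and does
not use them. -/
theorem mainTheorem1
    (ω : ℝ) (hω : 0 < ω) (f : ℝ → ℝ) (F : ℤ →₀ ℂ)
    (hf : ∀ t : ℝ, (f t : ℂ) =
      F.sum fun n c => c * Complex.exp (Complex.I * (n : ℂ) * (ω : ℂ) * (t : ℂ)))
    (hF0 : F 0 = 0)
    (hcond : TwoLevel.ConditionI f ∨ TwoLevel.ConditionII f) :
    ∃ K : ℝ, 0 < K ∧
      ∃ (Ω : ℝ → ℝ) (u11m u11p u12m u12p : ℝ → ℝ → ℂ) (c11m c11p c12m c12p : ℝ → ℤ → ℂ),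
        (∀ ε : ℝ, |ε| < K →
          ∃ U : ℝ → Matrix (Fin 2) (Fin 2) ℂ,
            TwoLevel.IsPropagator ε f U ∧
            (∀ t : ℝ, U t =
              !![U t 0 0, U t 0 1; -(starRingEnd ℂ) (U t 0 1), (starRingEnd ℂ) (U t 0 0)]) ∧
            (∀ t : ℝ, U t 0 0 =
              Complex.exp (-Complex.I * (Ω ε : ℂ) * (t : ℂ)) * u11m ε t +
                Complex.exp (Complex.I * (Ω ε : ℂ) * (t : ℂ)) * u11p ε t) ∧
            (∀ t : ℝ, U t 0 1 =
              Complex.exp (-Complex.I * (Ω ε : ℂ) * (t : ℂ)) * u12m ε t +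
                Complex.exp (Complex.I * (Ω ε : ℂ) * (t : ℂ)) * u12p ε t) ∧
            TwoLevel.HasFourierExpansion ω (u11m ε) (c11m ε) ∧
            TwoLevel.HasFourierExpansion ω (u11p ε) (c11p ε) ∧
            TwoLevel.HasFourierExpansion ω (u12m ε) (c12m ε) ∧
            TwoLevel.HasFourierExpansion ω (u12p ε) (c12p ε)) ∧
        TwoLevel.HasAbsPowerSeries K Ω ∧
        (∀ n : ℤ,
          TwoLevel.HasAbsPowerSeries K (fun ε => c11m ε n) ∧
          TwoLevel.HasAbsPowerSeries K (fun ε => c11p ε n) ∧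
          TwoLevel.HasAbsPowerSeries K (fun ε => c12m ε n) ∧
          TwoLevel.HasAbsPowerSeries K (fun ε => c12p ε n)) := by
  have hfd : ContDiff ℝ 1 f := contDiff_of_trigPoly hf
  have hfc := hfd.continuous
  have hB := abs_le_of_trigPoly hf
  have hper := periodic_of_trigPoly hf hω.ne'
  have hT0 := propagator_zero_period hf hω.ne' hF0
  have hT : (2 * Real.pi / ω : ℝ) ≠ 0 := by positivity
  set T := 2 * Real.pi / ω with hTdef
  have hTc : (T : ℂ) ≠ 0 := Complex.ofReal_ne_zero.mpr hT
  have han := fun i j => (differentiable_propagator (f := f) T i j).analyticAt 0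
  obtain ⟨θ, P, hθ, hP, hspec⟩ := exists_analytic_spectral_data (han 0 0) (han 0 1) (han 1 0)
    (han 1 1) (by simp [hT0]) (by simp [hT0]) (by simp [hT0]) (by simp [hT0])
    (fun ε => (propagator_conj hfc hB ε T).2)
    (fun ε => by rw [(propagator_conj hfc hB ε T).1]; simp)
    (fun ε => det_propagator hfc ε T)
  -- The spectral identities are known only for real `ε`, within `K₁`; analyticity holds on the
  -- complex disc of radius `K₂`.
  obtain ⟨K₁, hK₁, hreal⟩ := Metric.eventually_nhds_iff_ball.mp hspec
  obtain ⟨K₂, hK₂, hcomplex⟩ := Metric.eventually_nhds_iff_ball.mp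
    (hθ.eventually_analyticAt.and
      (eventually_all.mpr fun i => eventually_all.mpr fun j => (hP i j).eventually_analyticAt))
  set K := min K₁ K₂
  have hsub : Metric.ball (0 : ℂ) K ⊆ Metric.ball 0 K₂ := Metric.ball_subset_ball (min_le_right _ _)
  have hμp : DifferentiableOn ℂ (fun z => θ z / T) (Metric.ball 0 K) := fun z hz =>
    (hcomplex z (hsub hz)).1.differentiableAt.differentiableWithinAt.div_const _
  have hμm : DifferentiableOn ℂ (fun z => -(θ z / T)) (Metric.ball 0 K) := hμp.fun_neg
  have hQp : ∀ i j, DifferentiableOn ℂ (fun z => P z i j) (Metric.ball 0 K) := fun i j z hz =>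
    ((hcomplex z (hsub hz)).2 i j).differentiableAt.differentiableWithinAt
  have hQm : ∀ i j, DifferentiableOn ℂ (fun z => (1 - P z) i j) (Metric.ball 0 K) :=
    fun i j => (hQp i j).const_sub _
  -- The phase is real for real `ε`, so taking the real part to define `Ω` loses nothing.
  have hΩ : ∀ ε : ℝ, |ε| < K → (((θ ε / T).re : ℝ) : ℂ) = θ ε / T := fun ε hε => by
    have him := (hreal ε (by simpa using hε.trans_le (min_le_left _ _))).1
    apply Complex.ext
    · simp
    · simp [him]
  refine ⟨K, lt_min hK₁ hK₂, fun ε => (θ ε / T).re,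
    fun ε => floquetPart f (fun z => -(θ z / T)) (fun z => 1 - P z) 0 ε,
    fun ε => floquetPart f (fun z => θ z / T) P 0 ε,
    fun ε => floquetPart f (fun z => -(θ z / T)) (fun z => 1 - P z) 1 ε,
    fun ε => floquetPart f (fun z => θ z / T) P 1 ε,
    fun ε => fourierC ω (floquetPart f (fun z => -(θ z / T)) (fun z => 1 - P z) 0 ε),
    fun ε => fourierC ω (floquetPart f (fun z => θ z / T) P 0 ε),
    fun ε => fourierC ω (floquetPart f (fun z => -(θ z / T)) (fun z => 1 - P z) 1 ε),
    fun ε => fourierC ω (floquetPart f (fun z => θ z / T) P 1 ε),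
    fun ε hε => ?_, (hasAbsPowerSeries_of_differentiableOn hμp).re, fun n =>
      ⟨hasAbsPowerSeries_fourierC_floquetPart hfc hμm hQm ω 0 n,
        hasAbsPowerSeries_fourierC_floquetPart hfc hμp hQp ω 0 n,
        hasAbsPowerSeries_fourierC_floquetPart hfc hμm hQm ω 1 n,
        hasAbsPowerSeries_fourierC_floquetPart hfc hμp hQp ω 1 n⟩⟩
  obtain ⟨-, hPp, hPm⟩ := hreal ε (by simpa using hε.trans_le (min_le_left _ _))
  rw [← Matrix.eta_fin_two (propagator f ε T)] at hPp hPm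
  have hdecomp : ∀ (t : ℝ) (j : Fin 2), propagator f ε t 0 j =
      Complex.exp (-Complex.I * ((θ ε / T).re : ℝ) * t) *
        floquetPart f (fun z => -(θ z / T)) (fun z => 1 - P z) j ε t +
      Complex.exp (Complex.I * ((θ ε / T).re : ℝ) * t) *
        floquetPart f (fun z => θ z / T) P j ε t := fun t j => by
    rw [hΩ ε hε, floquetPart, floquetPart, ← mul_assoc, ← mul_assoc, ← Complex.exp_add,
      ← Complex.exp_add, Matrix.mul_sub, Matrix.mul_one, Matrix.sub_apply]
    ring_nf
    simp
  have hexp : ∀ j, HasFourierExpansion ω (floquetPart f (fun z => θ z / T) P j ε)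
      (fourierC ω (floquetPart f (fun z => θ z / T) P j ε)) := fun j =>
    hasFourierExpansion_of_contDiff hω (floquetPart_periodic hfc hB hper
      (by rw [hPp, mul_assoc, div_mul_cancel₀ _ hTc]) j) (contDiff_floquetPart hfd _ _ _ _)
  have hexm : ∀ j, HasFourierExpansion ω
      (floquetPart f (fun z => -(θ z / T)) (fun z => 1 - P z) j ε)
      (fourierC ω (floquetPart f (fun z => -(θ z / T)) (fun z => 1 - P z) j ε)) := fun j =>
    hasFourierExpansion_of_contDiff hω (floquetPart_periodic hfc hB hper
      (by rw [hPm, mul_assoc, neg_mul (θ ε / T), div_mul_cancel₀ _ hTc, neg_mul, mul_neg]) j)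
      (contDiff_floquetPart hfd _ _ _ _)
  refine ⟨fun t => propagator f ε t, isPropagator_propagator hfc hB ε, fun t => ?_,
    fun t => hdecomp t 0, fun t => hdecomp t 1, hexm 0, hexp 0, hexm 1, hexp 1⟩
  rw [← (propagator_conj hfc hB ε t).1, ← (propagator_conj hfc hB ε t).2]
  exact Matrix.eta_fin_two _
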